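/- Let $M$ be a locally compact, locally connected, metrizable space with a continuous flow $M\times\mathbb R\to M$, $(x,t)\mapsto x\cdot t$. Write $\omega(x)$, $\alpha(x)$ for the limit sets of $x$, and $$J^+(x)=\bigcap_{U\ni x\text{ open},\ t\ge 0}\overline{U\cdot[t,\infty)} .$$ A compact neighbourhood $N$ of a compact invariant set $K$ is an *isolating neighbourhood* of $K$ if $K=\{x\in N: x\cdot\mathbb R\subseteq N\}$; put $N^{+}=\{x\in N: x\cdot[0,\infty)\subseteq N\}$ and $N^{-}=\{x\in N: x\cdot(-\infty,0]\subseteq N\}$. It is an *isolating block* if moreover $\partial N=N^i\cup N^o$ with $N^i,N^o$ compact such that: for $x\in N^i$ (resp. $x\in N^o$) there is $\varepsilon>0$ with $x\cdot[-\varepsilon,0)\subseteq M\setminus N$ (resp. $x\cdot(0,\varepsilon]\subseteq M\setminus N$); and for $x\in\partial N\setminus N^i$ (resp. $x\in\partial N\setminus N^o$) there is $\varepsilon>0$ with $x\cdot[-\varepsilon,0)\subseteq\operatorname{int}N$ (resp. $x\cdot(0,\varepsilon]\subseteq\operatorname{int}N$). Let $K$ be an isolated attractor, that is, a compact invariant set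 which has an isolating neighbourhood and whose basin of attraction $\mathcal A(K)=\{x:\emptyset\neq\omega(x)\subseteq K\}$ is a neighbourhood of $K$. Suppose that $K$ has only internal explosions, that is, $J^+(x)\subseteq K$ for all $x\in\mathcal A(K)\setminus K$. Let $\widehat K=\bigcup_{x\in K}J^+(x)$ be the stabilization of $K$ and $\mathcal H(K)=\{x\in\mathcal A(K):\emptyset\ne\alpha(x)\subseteq K\}$ the set of homoclinic points. A compact set $S\subseteq C$ is a *topological section* of $C$ if $(x,t)\mapsto x\cdot t$ is a homeomorphism of $S\times\mathbb R$ onto $C$. Then: 1. $\mathcal A(K)\setminus K$ has finitely many connected components $C_1,\dots,C_s$, and these can be arranged so that for some $r\le s$ (a) $\widehat K=\mathcal H(K)=K\cup(C_1\cup\dots\cup C_r)$, (b) $\mathcal A(K)=\widehat K\cup(C_{r+1}\cup\dots\cup C_s)$. 2. With $r$, $s$ and the $C_j$ as in 1, $K$ has a neighbourhood basis consisting of isolating blocks $N$ such that $\partial N$ has exactly $r+s$ connected components $n_1^-,\dots,n_r^-\subseteq N^-$ and $n_1^+,\dots,n_s^+\subseteq N^+$, where $n_j^-$ and $n_j^+$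 are both topological sections of $C_j$ for $j\le r$, and $n_j^+$ is a topological section of $C_j$ for $r<j\le s$. -/

import Mathlib

open Set Filter Topology

namespace Flow

variable {M : Type*} [TopologicalSpace M] (φ : Flow ℝ M)

/-- The omega-limit set of a point. -/
def omegaSet (x : M) : Set M := omegaLimit atTop φ {x}

/-- The alpha-limit set of a point. -/
def alphaSet (x : M) : Set M := omegaLimit atBot φ {x}

/-- The positive prolongational limit set `J⁺(x)`: the intersection of the closures of
`U · [t, ∞)` over all open neighbourhoods `U` of `x` and all `t ≥ 0`. -/
def posProlongation (x : M) : Set M :=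
  {y | ∀ U : Set M, IsOpen U → x ∈ U → ∀ t : ℝ, 0 ≤ t → y ∈ closure (image2 φ (Ici t) U)}

/-- `N` is an isolating neighbourhood for `K`: a compact neighbourhood of `K` in which `K` is the
maximal invariant set. -/
def IsIsolatingNeighbourhood (K N : Set M) : Prop :=
  IsCompact N ∧ N ∈ 𝓝ˢ K ∧ K = {x | x ∈ N ∧ ∀ t : ℝ, φ t x ∈ N}

/-- `K` is an isolated compact invariant set. -/
def IsIsolatedInvariantSet (K : Set M) : Prop :=
  IsCompact K ∧ IsInvariant φ K ∧ ∃ N : Set M, φ.IsIsolatingNeighbourhood K N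

/-- The asymptotic set `N⁺` of points of `N` whose positive semitrajectory stays in `N`. -/
def posAsymptoticSet (N : Set M) : Set M := {x | x ∈ N ∧ ∀ t : ℝ, 0 ≤ t → φ t x ∈ N}

/-- The asymptotic set `N⁻` of points of `N` whose negative semitrajectory stays in `N`. -/
def negAsymptoticSet (N : Set M) : Set M := {x | x ∈ N ∧ ∀ t : ℝ, t ≤ 0 → φ t x ∈ N}

/-- `N` is an isolating block for `K`: an isolating neighbourhood whose boundary is the union of
a compact entrance set `Ni` and a compact exit set `No`. -/
def IsIsolatingBlock (K N : Set M) : Prop :=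
  φ.IsIsolatingNeighbourhood K N ∧
  ∃ Ni No : Set M, IsCompact Ni ∧ IsCompact No ∧ frontier N = Ni ∪ No ∧
    (∀ x ∈ Ni, ∃ ε : ℝ, 0 < ε ∧ ∀ t ∈ Ico (-ε) 0, φ t x ∉ N) ∧
    (∀ x ∈ No, ∃ δ : ℝ, 0 < δ ∧ ∀ t ∈ Ioc 0 δ, φ t x ∉ N) ∧
    (∀ x ∈ frontier N \ Ni, ∃ ε : ℝ, 0 < ε ∧ ∀ t ∈ Ico (-ε) 0, φ t x ∈ interior N) ∧
    (∀ x ∈ frontier N \ No, ∃ δ : ℝ, 0 < δ ∧ ∀ t ∈ Ioc 0 δ, φ t x ∈ interior N)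

/-- The stable manifold of `K`; when `K` is an isolated attractor this is its basin of
attraction. -/
def basin (K : Set M) : Set M := {x | (φ.omegaSet x).Nonempty ∧ φ.omegaSet x ⊆ K}

/-- `K` is an isolated attractor: an isolated compact invariant set whose stable manifold is a
neighbourhood of it. -/
def IsIsolatedAttractor (K : Set M) : Prop :=
  φ.IsIsolatedInvariantSet K ∧ φ.basin K ∈ 𝓝ˢ K

/-- `K` is an isolated attractor with only internal explosions: every point `x` of the basin with
`J⁺(x) ⊄ K` belongs to `K`. -/
def IsAttractorWithOnlyInternalExplosions (K : Set M) : Prop :=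
  φ.IsIsolatedAttractor K ∧ ∀ x ∈ φ.basin K \ K, φ.posProlongation x ⊆ K

/-- The stabilization of an attractor `K`: the union of the sets `J⁺(x)` for `x ∈ K`. -/
def stabilization (K : Set M) : Set M := ⋃ x ∈ K, φ.posProlongation x

/-- The set of homoclinic points: those whose alpha- and omega-limit sets are both nonempty and
contained in `K`. -/
def homoclinicSet (K : Set M) : Set M :=
  {x | x ∈ φ.basin K ∧ (φ.alphaSet x).Nonempty ∧ φ.alphaSet x ⊆ K}

/-- `S` is a (compact) topological section of `C`: the flow restricts to a homeomorphism of
`S × ℝ` onto `C`. -/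
def IsTopologicalSection (S C : Set M) : Prop :=
  IsCompact S ∧ S ⊆ C ∧ ∃ h : (S × ℝ) ≃ₜ C, ∀ p : S × ℝ, (h p : M) = φ p.2 p.1

end Flow

/-- The set of connected components of a subset `S` of a topological space. -/
def componentsOf {M : Type*} [TopologicalSpace M] (S : Set M) : Set (Set M) :=
  (fun x => connectedComponentIn S x) '' S

/-! Write X for the basin minus K. Since J⁺(x) ⊆ K on X, compact subsets of X are attracted
uniformly into every neighbourhood of K (`exists_forall_ge_mem`), so they are wandering. All orbits
in X cross the compact frontier of a small isolating neighbourhood V of K, so averaging time against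
a bump function gives a continuous τ on X that grows at unit speed and has compact levels
(`exists_isSectionTime`). Thus X is a product of a compact level and ℝ. Its components are open and
invariant, so each meets that level, and there are finitely many.

Orbits tend to K uniformly as τ → ∞. In the past, τ is bounded below on the compact frontier of V,
so before some time no orbit crosses it: an orbit lies in V for all earlier times, and is then
homoclinic by isolation, or avoids V. Hence the homoclinic part G is clopen in X and is a union of
components (`exists_isBlockTime`).

The blocks are K together with the late points of X and the early points of G (`timeBlock`). Their
frontiers consist of the level T in X and the level -T in G; each level meets each component in a
connected topological section. The late points, K and all of G form a closed set containing the
forward images of a neighbourhood of K. Letting T → ∞ bounds the stabilization by K ∪ G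
(`posProlongation_subset`); the reverse inclusion holds because x ∈ J⁺(y) for y ∈ α(x). -/

namespace Flow

/-! ### Limit sets and uniform attraction of compact sets -/

section LimitSets

variable {M : Type*} [TopologicalSpace M] (φ : Flow ℝ M)

/-- Off the frontier, the interior and the exterior of `V` split the time interval into two disjoint
open sets, so connectedness leaves only one. Every argument below that an orbit cannot enter or
leave a neighbourhood goes through this. -/
theorem mem_interior_of_forall_notMem_frontier {I : Set ℝ} (hI : IsPreconnected I) {V : Set M}
    {x : M} (h : ∀ t ∈ I, φ t x ∉ frontier V) {a b : ℝ} (ha : a ∈ I) (hb : b ∈ I)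
    (hav : φ a x ∈ V) : φ b x ∈ interior V := by
  have hc : Continuous fun t : ℝ => φ t x := by fun_prop
  have key : I ⊆ (fun t : ℝ => φ t x) ⁻¹' interior V := by
    refine hI.subset_left_of_subset_union (isOpen_interior.preimage hc)
      (isClosed_closure.isOpen_compl.preimage hc : IsOpen ((fun t : ℝ => φ t x) ⁻¹' (closure V)ᶜ))
      ?_ ?_ ⟨a, ha, ?_⟩
    · exact Disjoint.preimage _ (disjoint_compl_right_iff_subset.2 interior_subset_closure)
    · intro t ht
      by_cases h1 : φ t x ∈ closure V
      · exact Or.inl (by_contra fun h2 => h t ht ⟨h1, h2⟩)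
      · exact Or.inr h1
    · exact by_contra fun h2 => h a ha ⟨subset_closure hav, h2⟩
  exact key hb

theorem flow_neg_flow (t : ℝ) (x : M) : φ (-t) (φ t x) = x := by
  rw [← φ.map_add, neg_add_cancel, φ.map_zero_apply]

theorem flow_flow_neg (t : ℝ) (x : M) : φ t (φ (-t) x) = x := by
  rw [← φ.map_add, add_neg_cancel, φ.map_zero_apply]

theorem exists_ge_mem_of_mem_omegaSet {x z : M} (hz : z ∈ φ.omegaSet x) {W : Set M}
    (hW : W ∈ 𝓝 z) (T : ℝ) : ∃ t, T ≤ t ∧ φ t x ∈ W := by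
  have h1 : z ∈ closure (image2 φ (Ici T) {x}) :=
    omegaLimit_subset_closure_image2 _ _ _ (Ici_mem_atTop T) hz
  obtain ⟨_, h2, t, ht, y, rfl, rfl⟩ := mem_closure_iff_nhds.1 h1 W hW
  exact ⟨t, ht, h2⟩

theorem exists_le_mem_of_mem_alphaSet {x z : M} (hz : z ∈ φ.alphaSet x) {W : Set M}
    (hW : W ∈ 𝓝 z) (T : ℝ) : ∃ t, t ≤ T ∧ φ t x ∈ W := by
  have h1 : z ∈ closure (image2 φ (Iic T) {x}) :=
    omegaLimit_subset_closure_image2 _ _ _ (Iic_mem_atBot T) hz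
  obtain ⟨_, h2, t, ht, y, rfl, rfl⟩ := mem_closure_iff_nhds.1 h1 W hW
  exact ⟨t, ht, h2⟩

theorem omegaSet_flow (t : ℝ) (x : M) : φ.omegaSet (φ t x) = φ.omegaSet x := by
  have := Flow.omegaLimit_image_eq (f := atTop) φ {x} (fun t => tendsto_atTop_add_const_right _ t tendsto_id) t
  simpa [omegaSet] using this

theorem alphaSet_flow (t : ℝ) (x : M) : φ.alphaSet (φ t x) = φ.alphaSet x := by
  have := Flow.omegaLimit_image_eq (f := atBot) φ {x} (fun t => tendsto_atBot_add_const_right _ t tendsto_id) t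
  simpa [alphaSet] using this

theorem isInvariant_alphaSet (x : M) : IsInvariant φ (φ.alphaSet x) :=
  Flow.isInvariant_omegaLimit _ _ _ fun t => tendsto_atBot_add_const_left _ t tendsto_id

theorem omegaSet_of_forall_ge_mem [T2Space M] {V : Set M} (hV : IsCompact V) {x : M} {T : ℝ}
    (h : ∀ t, T ≤ t → φ t x ∈ V) : (φ.omegaSet x).Nonempty ∧ φ.omegaSet x ⊆ V := by
  have h1 : closure (image2 φ (Ici T) {x}) ⊆ V := by
    refine closure_minimal ?_ hV.isClosed
    rintro _ ⟨t, ht, y, rfl, rfl⟩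
    exact h t ht
  exact ⟨nonempty_omegaLimit_of_isCompact_absorbing _ _ _ hV ⟨_, Ici_mem_atTop T, h1⟩
    (singleton_nonempty x), (omegaLimit_subset_closure_image2 _ _ _ (Ici_mem_atTop T)).trans h1⟩

theorem alphaSet_of_forall_le_mem [T2Space M] {V : Set M} (hV : IsCompact V) {x : M} {T : ℝ}
    (h : ∀ t, t ≤ T → φ t x ∈ V) : (φ.alphaSet x).Nonempty ∧ φ.alphaSet x ⊆ V := by
  have h1 : closure (image2 φ (Iic T) {x}) ⊆ V := by
    refine closure_minimal ?_ hV.isClosed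
    rintro _ ⟨t, ht, y, rfl, rfl⟩
    exact h t ht
  exact ⟨nonempty_omegaLimit_of_isCompact_absorbing _ _ _ hV ⟨_, Iic_mem_atBot T, h1⟩
    (singleton_nonempty x), (omegaLimit_subset_closure_image2 _ _ _ (Iic_mem_atBot T)).trans h1⟩

theorem isInvariant_basin (K : Set M) : IsInvariant φ (φ.basin K) := fun t x hx => by
  simpa only [basin, mem_ofPred_eq, omegaSet_flow] using hx

theorem subset_basin [T2Space M] {K : Set M} (hK : IsCompact K) (hinv : IsInvariant φ K) :
    K ⊆ φ.basin K := fun _ hx =>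
  φ.omegaSet_of_forall_ge_mem hK (T := 0) fun t _ => hinv t hx

theorem subset_homoclinicSet [T2Space M] {K : Set M} (hK : IsCompact K) (hinv : IsInvariant φ K) :
    K ⊆ φ.homoclinicSet K := fun _ hx =>
  ⟨φ.subset_basin hK hinv hx, φ.alphaSet_of_forall_le_mem hK (T := 0) fun t _ => hinv t hx⟩

theorem isInvariant_diff {A K : Set M} (hA : IsInvariant φ A) (hK : IsInvariant φ K) :
    IsInvariant φ (A \ K) := fun t x hx =>
  ⟨hA t hx.1, fun h => hx.2 (by simpa only [flow_neg_flow] using hK (-t) h)⟩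

/-- An orbit of the basin enters the interior of the basin at some time t; nearby points do so too
at time t, and invariance brings them back. -/
theorem isOpen_basin {K : Set M} (h : φ.basin K ∈ 𝓝ˢ K) : IsOpen (φ.basin K) := by
  rw [isOpen_iff_mem_nhds]
  intro x hx
  obtain ⟨z, hz⟩ := hx.1
  obtain ⟨t, -, ht⟩ := φ.exists_ge_mem_of_mem_omegaSet hz
    (interior_mem_nhds.2 (mem_nhdsSet_iff_forall.1 h z (hx.2 hz))) 0
  have hc : Continuous fun y : M => φ t y := by fun_prop
  filter_upwards [(isOpen_interior.preimage hc).mem_nhds ht] with y hy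
  simpa only [flow_neg_flow] using φ.isInvariant_basin K (-t) (interior_subset hy)

/-- A point of the basin whose positive prolongational limit set lies in `K` is attracted by `K`
uniformly on a neighbourhood. -/
theorem exists_nhds_forall_ge_mem [T2Space M] {K V : Set M} (hV : IsCompact V) (hVK : V ∈ 𝓝ˢ K) {x : M}
    (hx : x ∈ φ.basin K) (hJ : φ.posProlongation x ⊆ K) :
    ∃ U ∈ 𝓝 x, ∃ T : ℝ, ∀ y ∈ U, ∀ t, T ≤ t → φ t y ∈ V := by
  have hF : IsCompact (frontier V) :=
    hV.of_isClosed_subset isClosed_frontier hV.isClosed.frontier_subset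
  have h1 : ∃ U ∈ 𝓝 x, ∃ T : ℝ, ∀ y ∈ U, ∀ t, T ≤ t → φ t y ∉ frontier V := by
    -- Frontier points lie outside `K`, hence outside J⁺(x), so each has a neighbourhood that all
    -- orbits starting near x eventually avoid; compactness makes the time uniform.
    refine hF.induction_on (p := fun s => ∃ U ∈ 𝓝 x, ∃ T : ℝ, ∀ y ∈ U, ∀ t, T ≤ t → φ t y ∉ s)
      ?_ ?_ ?_ ?_
    · exact ⟨univ, univ_mem, 0, by simp⟩
    · rintro s s' hss ⟨U, hU, T, h⟩
      exact ⟨U, hU, T, fun y hy t ht hm => h y hy t ht (hss hm)⟩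
    · rintro s s' ⟨U, hU, T, h⟩ ⟨U', hU', T', h'⟩
      refine ⟨U ∩ U', inter_mem hU hU', max T T', fun y hy t ht hm => ?_⟩
      rcases hm with hm | hm
      · exact h y hy.1 t ((le_max_left _ _).trans ht) hm
      · exact h' y hy.2 t ((le_max_right _ _).trans ht) hm
    · intro z hz
      have hzK : z ∉ K := fun hzK =>
        hz.2 (mem_interior_iff_mem_nhds.2 (mem_nhdsSet_iff_forall.1 hVK z hzK))
      have hzJ : z ∉ φ.posProlongation x := fun h => hzK (hJ h)
      simp only [posProlongation, mem_ofPred_eq, not_forall] at hzJ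
      obtain ⟨U, hU, hxU, T, -, h⟩ := hzJ
      exact ⟨(closure (image2 φ (Ici T) U))ᶜ,
        mem_nhdsWithin_of_mem_nhds (isClosed_closure.isOpen_compl.mem_nhds h),
        U, hU.mem_nhds hxU, T, fun y hy t ht hm => hm (subset_closure ⟨t, ht, y, hy, rfl⟩)⟩
  obtain ⟨U, hU, T, h⟩ := h1
  -- After time `T` no crossing is possible, so it suffices that x, and with it nearby points, is in
  -- the interior of `V` at a single later time.
  obtain ⟨z, hz⟩ := hx.1
  obtain ⟨t, htT, ht⟩ := φ.exists_ge_mem_of_mem_omegaSet hz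
    (interior_mem_nhds.2 (mem_nhdsSet_iff_forall.1 hVK z (hx.2 hz))) T
  have hc : Continuous fun y : M => φ t y := by fun_prop
  refine ⟨U ∩ (fun y : M => φ t y) ⁻¹' interior V,
    inter_mem hU ((isOpen_interior.preimage hc).mem_nhds ht), t, fun y hy u hu => ?_⟩
  exact interior_subset (φ.mem_interior_of_forall_notMem_frontier (isPreconnected_Ici (a := T))
    (fun v hv => h y hy.1 v hv) htT (htT.trans hu) (interior_subset hy.2))

theorem exists_forall_ge_mem_of_isCompact [T2Space M] {K V Q : Set M} (hV : IsCompact V)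
    (hVK : V ∈ 𝓝ˢ K) (hQ : IsCompact Q) (hQb : Q ⊆ φ.basin K)
    (hJ : ∀ x ∈ Q, φ.posProlongation x ⊆ K) :
    ∃ T : ℝ, ∀ y ∈ Q, ∀ t, T ≤ t → φ t y ∈ V := by
  refine hQ.induction_on (p := fun s => ∃ T : ℝ, ∀ y ∈ s, ∀ t, T ≤ t → φ t y ∈ V) ?_ ?_ ?_ ?_
  · exact ⟨0, by simp⟩
  · rintro s s' hss ⟨T, h⟩
    exact ⟨T, fun y hy => h y (hss hy)⟩
  · rintro s s' ⟨T, h⟩ ⟨T', h'⟩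
    refine ⟨max T T', fun y hy t ht => ?_⟩
    rcases hy with hy | hy
    · exact h y hy t ((le_max_left _ _).trans ht)
    · exact h' y hy t ((le_max_right _ _).trans ht)
  · intro x hx
    obtain ⟨U, hU, T, h⟩ := φ.exists_nhds_forall_ge_mem hV hVK (hQb hx) (hJ x hx)
    exact ⟨U, mem_nhdsWithin_of_mem_nhds hU, T, h⟩

end LimitSets

end Flow

/-! ### Section times and the product structure they give -/

namespace Flow

section SectionTime

variable {M : Type*} [TopologicalSpace M] (φ : Flow ℝ M)

/-- A real-valued function on an open invariant set `X` that is continuous and increases with unit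
speed along the orbits. -/
structure IsSectionTime (X : Set M) (τ : M → ℝ) : Prop where
  isOpen : IsOpen X
  isInvariant : IsInvariant φ X
  continuousOn : ContinuousOn τ X
  map_flow : ∀ x ∈ X, ∀ t, τ (φ t x) = τ x + t

/-- If all orbits in `X` meet a compact subset of `X` and compact subsets of `X` are wandering, then
the mean time that orbits spend near that compact subset gives a section time. -/
theorem exists_isSectionTime [T2Space M] [LocallyCompactSpace M] [FirstCountableTopology M]
    {X P : Set M} (hX : IsOpen X) (hXinv : IsInvariant φ X) (hP : IsCompact P) (hPX : P ⊆ X)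
    (hmeet : ∀ x ∈ X, ∃ t, φ t x ∈ P)
    (hdisp : ∀ Q, IsCompact Q → Q ⊆ X → ∃ T : ℝ, ∀ x ∈ Q, ∀ t, T ≤ t → φ t x ∉ Q) :
    ∃ τ, φ.IsSectionTime X τ := by
  obtain ⟨k, hk1, hkc, hkX, hk01⟩ := exists_continuousMap_one_of_isCompact_subset_isOpen hP hX hPX
  -- `I 0` is the total time, weighted by `k`, that the orbit spends near `P`, and `I 1` is the
  -- first moment.
  let I : ℕ → M → ℝ := fun n x => ∫ t : ℝ, t ^ n * k (φ t x)
  have hloc : ∀ x ∈ X, ∃ U ∈ 𝓝 x, ∃ T : ℝ, ∀ y ∈ U, ∀ t, T ≤ |t| → k (φ t y) = 0 := by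
    intro x hx
    obtain ⟨U, hUc, hxU, hUX⟩ := exists_compact_subset hX hx
    -- Taking the union handles both signs of time: a visit to the support at a negative time is a
    -- passage from the support back to `U`.
    obtain ⟨T, hT⟩ := hdisp (U ∪ tsupport k) (hUc.union hkc) (union_subset hUX hkX)
    refine ⟨U, mem_interior_iff_mem_nhds.1 hxU, T, fun y hy t ht => ?_⟩
    by_contra hne
    have hmem : φ t y ∈ tsupport k := subset_tsupport _ hne
    rcases le_abs.1 ht with h | h
    · exact hT y (Or.inl hy) t h (Or.inr hmem)
    · refine hT (φ t y) (Or.inr hmem) (-t) h (Or.inl ?_)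
      rwa [flow_neg_flow]
  have hcont : ∀ (n : ℕ) (x : M), Continuous fun t : ℝ => t ^ n * k (φ t x) := by
    intro n x; fun_prop
  have hsupp : ∀ (n : ℕ), ∀ x ∈ X, HasCompactSupport fun t : ℝ => t ^ n * k (φ t x) := by
    intro n x hx
    obtain ⟨U, hU, T, h⟩ := hloc x hx
    refine HasCompactSupport.intro (isCompact_Icc (a := -T) (b := T)) fun t ht => ?_
    have : T ≤ |t| := by
      by_contra hlt
      exact ht (mem_Icc.2 (abs_le.1 (not_le.1 hlt).le))
    simp [h x (mem_of_mem_nhds hU) t this]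
  have hint : ∀ (n : ℕ), ∀ x ∈ X, MeasureTheory.Integrable fun t : ℝ => t ^ n * k (φ t x) :=
    fun n x hx => (hcont n x).integrable_of_hasCompactSupport (hsupp n x hx)
  have hIcont : ∀ n, ContinuousOn (I n) X := by
    intro n x hx
    refine ContinuousAt.continuousWithinAt ?_
    obtain ⟨U, hU, T, h⟩ := hloc x hx
    have heq : I n =ᶠ[𝓝 x] fun y => ∫ t in (-T)..T, t ^ n * k (φ t y) := by
      filter_upwards [hU] with y hy
      refine (intervalIntegral.integral_eq_integral_of_support_subset fun t ht => ?_).symm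
      have : ¬ T ≤ |t| := fun hle => ht (by simp [h y hy t hle])
      have := abs_lt.1 (not_le.1 this)
      exact ⟨this.1, this.2.le⟩
    have hc : Continuous fun y => ∫ t in (-T)..T, t ^ n * k (φ t y) :=
      intervalIntegral.continuous_parametric_intervalIntegral_of_continuous'
        (f := fun y t => t ^ n * k (φ t y)) (by unfold Function.uncurry; fun_prop) _ _
    exact hc.continuousAt.congr heq.symm
  have hpos : ∀ x ∈ X, 0 < I 0 x := by
    intro x hx
    obtain ⟨t, ht⟩ := hmeet x hx
    refine (hcont 0 x).integral_pos_of_hasCompactSupport_nonneg_nonzero (hsupp 0 x hx) ?_ (x := t) ?_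
    · intro t
      simpa using (hk01 (φ t x)).1
    · simp [hk1 ht]
  have hshift : ∀ (g : ℝ → ℝ) (x : M) (s : ℝ),
      ∫ t : ℝ, g t * k (φ t (φ s x)) = ∫ t : ℝ, g (t - s) * k (φ t x) := by
    intro g x s
    rw [← MeasureTheory.integral_add_right_eq_self (fun t : ℝ => g (t - s) * k (φ t x)) s]
    simp only [add_sub_cancel_right, φ.map_add]
  have hI0 : ∀ x s, I 0 (φ s x) = I 0 x := by
    intro x s
    simpa [I] using hshift (fun _ => 1) x s
  have hI1 : ∀ x ∈ X, ∀ s, I 1 (φ s x) = I 1 x - s * I 0 x := by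
    intro x hx s
    have h1 : I 1 (φ s x) = ∫ t : ℝ, (t ^ 1 * k (φ t x) - s * (t ^ 0 * k (φ t x))) := by
      simp only [I]
      rw [hshift (fun t => t ^ 1)]
      congr 1 with t
      ring
    rw [h1, MeasureTheory.integral_sub (hint 1 x hx) ((hint 0 x hx).const_mul s),
      MeasureTheory.integral_const_mul]
  -- Flowing by s fixes `I 0` and lowers the mean time `I 1 / I 0` by s, whence the sign.
  refine ⟨fun x => -(I 1 x / I 0 x), hX, hXinv,
    ((hIcont 1).div (hIcont 0) fun x hx => (hpos x hx).ne').neg, fun x hx t => ?_⟩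
  have := (hpos x hx).ne'
  simp only [hI0, hI1 x hx]
  field_simp
  ring

variable {φ} {X : Set M} {τ : M → ℝ}

namespace IsSectionTime

variable (h : φ.IsSectionTime X τ)
include h

/-- Moving each point of `X` to time `c` along its orbit is continuous. -/
theorem continuousOn_flow_sub (c : ℝ) : ContinuousOn (fun x => φ (c - τ x) x) X := by
  have h1 : Continuous fun p : ℝ × M => φ p.1 p.2 := by fun_prop
  exact h1.comp_continuousOn
    ((continuousOn_const.sub h.continuousOn).prodMk continuousOn_id)

theorem time_flow_sub (c : ℝ) {x : M} (hx : x ∈ X) : τ (φ (c - τ x) x) = c := by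
  rw [h.map_flow x hx]; ring

theorem flow_sub_flow (c t : ℝ) {x : M} (hx : x ∈ X) :
    φ (c - τ (φ t x)) (φ t x) = φ (c - τ x) x := by
  rw [h.map_flow x hx, ← φ.map_add]; congr 1; ring

/-- The continuous inverse slides x to time c and records the elapsed time τ x - c. -/
theorem isTopologicalSection {C : Set M} (hC : C ⊆ X) (hCinv : IsInvariant φ C) (c : ℝ)
    (hcomp : IsCompact {x | x ∈ C ∧ τ x = c}) :
    φ.IsTopologicalSection {x | x ∈ C ∧ τ x = c} C := by
  have hτ : Continuous fun x : C => τ x :=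
    continuousOn_iff_continuous_domRestrict.1 (h.continuousOn.mono hC)
  refine ⟨hcomp, fun x hx => hx.1, ?_⟩
  refine ⟨⟨⟨fun p => ⟨φ p.2 p.1, hCinv p.2 p.1.2.1⟩,
    fun x => (⟨φ (c - τ x) x, hCinv _ x.2, h.time_flow_sub c (hC x.2)⟩, τ x - c), ?_, ?_⟩,
    ?_, ?_⟩, fun p => rfl⟩
  · rintro ⟨⟨x, hx, hxc⟩, t⟩
    have h1 : τ (φ t x) = c + t := by rw [h.map_flow x (hC hx), hxc]
    ext
    · simp only [h.flow_sub_flow c t (hC hx), hxc, sub_self, φ.map_zero_apply]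
    · simp [h1]
  · rintro ⟨x, hx⟩
    ext
    simp only [← φ.map_add, sub_add_sub_cancel, sub_self, φ.map_zero_apply]
  · exact Continuous.subtype_mk (by fun_prop) _
  · refine Continuous.prodMk (Continuous.subtype_mk ?_ _) (hτ.sub continuous_const)
    exact φ.continuous (continuous_const.sub hτ) continuous_subtype_val

/-- Sliding to time c is continuous and, since every orbit meets `P`, maps `P` onto the level. -/
theorem isCompact_level {P : Set M} (hP : IsCompact P) (hPX : P ⊆ X)
    (hmeet : ∀ x ∈ X, ∃ t, φ t x ∈ P) (c : ℝ) : IsCompact {x | x ∈ X ∧ τ x = c} := by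
  have h1 : {x | x ∈ X ∧ τ x = c} = (fun x => φ (c - τ x) x) '' P := by
    ext x
    constructor
    · rintro ⟨hx, hxc⟩
      obtain ⟨t, ht⟩ := hmeet x hx
      refine ⟨φ t x, ht, ?_⟩
      simp only [h.flow_sub_flow c t hx, hxc, sub_self, φ.map_zero_apply]
    · rintro ⟨y, hy, rfl⟩
      exact ⟨h.isInvariant _ (hPX hy), h.time_flow_sub c (hPX hy)⟩
  rw [h1]
  exact hP.image_of_continuousOn ((h.continuousOn_flow_sub c).mono hPX)

theorem isCompact_slab (hS : IsCompact {x | x ∈ X ∧ τ x = 0}) (T : ℝ) :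
    IsCompact {x | x ∈ X ∧ |τ x| ≤ T} := by
  have h1 : {x | x ∈ X ∧ |τ x| ≤ T} = image2 φ (Icc (-T) T) {x | x ∈ X ∧ τ x = 0} := by
    ext x
    constructor
    · rintro ⟨hx, hxT⟩
      refine ⟨τ x, abs_le.1 hxT, φ (0 - τ x) x, ⟨h.isInvariant _ hx, h.time_flow_sub 0 hx⟩, ?_⟩
      rw [zero_sub, flow_flow_neg]
    · rintro ⟨t, ht, y, ⟨hy, hy0⟩, rfl⟩
      refine ⟨h.isInvariant _ hy, ?_⟩
      rw [h.map_flow y hy, hy0, zero_add]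
      exact abs_le.2 ht
  rw [h1, ← image_uncurry_prod]
  exact (isCompact_Icc.prod hS).image φ.cont'

theorem isOpen_preimage {O : Set ℝ} (hO : IsOpen O) : IsOpen {x | x ∈ X ∧ τ x ∈ O} :=
  h.continuousOn.isOpen_inter_preimage h.isOpen hO

end IsSectionTime

end SectionTime

end Flow

/-! ### Connected components and their enumeration -/

theorem componentsOf_iUnion {M ι : Type*} [TopologicalSpace M] [Finite ι] {A : ι → Set M}
    (hclosed : ∀ i, IsClosed (A i)) (hconn : ∀ i, IsConnected (A i))
    (hdisj : Pairwise fun i j => Disjoint (A i) (A j)) :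
    componentsOf (⋃ i, A i) = range A := by
  have key : ∀ i, ∀ x ∈ A i, connectedComponentIn (⋃ i, A i) x = A i := by
    intro i x hx
    refine Subset.antisymm ?_ ((hconn i).isPreconnected.subset_connectedComponentIn hx
      (subset_iUnion A i))
    have hd : Disjoint (A i) (⋃ j : {j // j ≠ i}, A j) :=
      disjoint_iUnion_right.2 fun j => hdisj j.2.symm
    have hcov : connectedComponentIn (⋃ i, A i) x ⊆ A i ∪ ⋃ j : {j // j ≠ i}, A j := by
      intro y hy
      obtain ⟨j, hj⟩ := mem_iUnion.1 (connectedComponentIn_subset _ _ hy)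
      by_cases hji : j = i
      · exact Or.inl (hji ▸ hj)
      · exact Or.inr (mem_iUnion.2 ⟨⟨j, hji⟩, hj⟩)
    rcases isPreconnected_iff_subset_of_disjoint_closed.1 isPreconnected_connectedComponentIn _ _
      (hclosed i) (isClosed_iUnion_of_finite fun j : {j // j ≠ i} => hclosed j) hcov
      (by rw [hd.inter_eq, inter_empty]) with h | h
    · exact h
    · exact absurd (h (mem_connectedComponentIn (mem_iUnion.2 ⟨i, hx⟩)))
        (disjoint_left.1 hd hx)
  ext S
  constructor
  · rintro ⟨x, hx, rfl⟩
    obtain ⟨i, hi⟩ := mem_iUnion.1 hx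
    exact ⟨i, (key i x hi).symm⟩
  · rintro ⟨i, rfl⟩
    obtain ⟨x, hx⟩ := (hconn i).nonempty
    exact ⟨x, mem_iUnion.2 ⟨i, hx⟩, key i x hx⟩

section Components

variable {M : Type*} [TopologicalSpace M] {X C C' : Set M}

theorem subset_of_mem_componentsOf (hC : C ∈ componentsOf X) : C ⊆ X := by
  obtain ⟨x, -, rfl⟩ := hC
  exact connectedComponentIn_subset _ _

theorem isConnected_of_mem_componentsOf (hC : C ∈ componentsOf X) : IsConnected C := by
  obtain ⟨x, hx, rfl⟩ := hC
  exact isConnected_connectedComponentIn_iff.2 hx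

theorem eq_connectedComponentIn_of_mem_componentsOf (hC : C ∈ componentsOf X) {x : M}
    (hx : x ∈ C) : C = connectedComponentIn X x := by
  obtain ⟨y, -, rfl⟩ := hC
  exact connectedComponentIn_eq hx

theorem disjoint_of_mem_componentsOf (hC : C ∈ componentsOf X) (hC' : C' ∈ componentsOf X)
    (hne : C ≠ C') : Disjoint C C' :=
  disjoint_left.2 fun _ hx hx' => hne <|
    (eq_connectedComponentIn_of_mem_componentsOf hC hx).trans
      (eq_connectedComponentIn_of_mem_componentsOf hC' hx').symm

theorem sUnion_componentsOf : ⋃₀ componentsOf X = X :=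
  Subset.antisymm (sUnion_subset fun _ => subset_of_mem_componentsOf) fun x hx =>
    ⟨_, ⟨x, hx, rfl⟩, mem_connectedComponentIn hx⟩

theorem isOpen_of_mem_componentsOf [LocallyConnectedSpace M] (hX : IsOpen X)
    (hC : C ∈ componentsOf X) : IsOpen C := by
  obtain ⟨x, -, rfl⟩ := hC
  exact hX.connectedComponentIn

/-- The difference is the union of the other components, all open. Components are thus clopen in
`X`, which makes their traces on compact levels compact. -/
theorem isOpen_diff_of_mem_componentsOf [LocallyConnectedSpace M] (hX : IsOpen X)
    (hC : C ∈ componentsOf X) : IsOpen (X \ C) := by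
  have h1 : X \ C = ⋃₀ (componentsOf X \ {C}) := by
    ext x
    constructor
    · rintro ⟨hx, hxC⟩
      refine ⟨_, ⟨⟨x, hx, rfl⟩, fun h => hxC ?_⟩, mem_connectedComponentIn hx⟩
      rw [← mem_singleton_iff.1 h]
      exact mem_connectedComponentIn hx
    · rintro ⟨C', ⟨hC', hne⟩, hx⟩
      exact ⟨subset_of_mem_componentsOf hC' hx,
        disjoint_left.1 (disjoint_of_mem_componentsOf hC' hC hne) hx⟩
  rw [h1]
  exact isOpen_sUnion fun C' hC' => isOpen_of_mem_componentsOf hX hC'.1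

theorem finite_componentsOf_of_isCompact [LocallyConnectedSpace M] (hX : IsOpen X) {S : Set M}
    (hS : IsCompact S) (hSX : S ⊆ X) (hmeet : ∀ C ∈ componentsOf X, (C ∩ S).Nonempty) :
    (componentsOf X).Finite := by
  obtain ⟨t, htS, ht⟩ := hS.elim_nhds_subcover (connectedComponentIn X) fun x hx =>
    hX.connectedComponentIn.mem_nhds (mem_connectedComponentIn (hSX hx))
  refine (t.finite_toSet.image (connectedComponentIn X)).subset fun C hC => ?_
  obtain ⟨x, hxC, hxS⟩ := hmeet C hC
  obtain ⟨y, hy, hxy⟩ := mem_iUnion₂.1 (ht hxS)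
  refine ⟨y, hy, ?_⟩
  rw [eq_connectedComponentIn_of_mem_componentsOf hC hxC]
  exact connectedComponentIn_eq hxy

theorem Flow.isInvariant_of_mem_componentsOf (φ : Flow ℝ M) (hX : IsInvariant φ X)
    (hC : C ∈ componentsOf X) : IsInvariant φ C := by
  intro t x hx
  have hc : Continuous fun t : ℝ => φ t x := by fun_prop
  have h1 : IsPreconnected (range fun t : ℝ => φ t x) := isPreconnected_range hc
  have h2 := h1.subset_connectedComponentIn (F := X) (x := x) ⟨0, φ.map_zero_apply x⟩
    (range_subset_iff.2 fun t => hX t (subset_of_mem_componentsOf hC hx))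
  rw [eq_connectedComponentIn_of_mem_componentsOf hC hx]
  exact h2 ⟨t, rfl⟩

end Components

/-- The elements of a finite set can be enumerated so that those satisfying `p` come first. -/
theorem Set.Finite.exists_enumeration {α : Type*} {F : Set α} (hF : F.Finite) (p : α → Prop) :
    ∃ (s r : ℕ) (hrs : r ≤ s) (C : Fin s → α), Function.Injective C ∧ range C = F ∧
      (∀ j : Fin r, p (C (Fin.castLE hrs j))) ∧ ∀ j : Fin s, r ≤ (j : ℕ) → ¬ p (C j) := by
  obtain ⟨r, f, hf⟩ := (hF.subset (sep_subset F p)).fin_embedding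
  obtain ⟨m, g, hg⟩ := (hF.subset (sep_subset F fun a => ¬ p a)).fin_embedding
  have hf' : ∀ i, f i ∈ {a ∈ F | p a} := fun i => hf ▸ mem_range_self i
  have hg' : ∀ i, g i ∈ {a ∈ F | ¬ p a} := fun i => hg ▸ mem_range_self i
  refine ⟨r + m, r, Nat.le_add_right r m, Fin.append f g, ?_, ?_, ?_, ?_⟩
  · rw [Fin.append_injective_iff]
    exact ⟨f.injective, g.injective, fun i j hij => (hg' j).2 (hij ▸ (hf' i).2)⟩
  · ext a
    constructor
    · rintro ⟨j, rfl⟩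
      refine Fin.addCases (fun i => ?_) (fun i => ?_) j
      · rw [Fin.append_left]; exact (hf' i).1
      · rw [Fin.append_right]; exact (hg' i).1
    · intro ha
      by_cases hp : p a
      · obtain ⟨i, rfl⟩ : a ∈ range f := by rw [hf]; exact ⟨ha, hp⟩
        exact ⟨Fin.castAdd m i, Fin.append_left _ _ _⟩
      · obtain ⟨i, rfl⟩ : a ∈ range g := by rw [hg]; exact ⟨ha, hp⟩
        exact ⟨Fin.natAdd r i, Fin.append_right _ _ _⟩
  · intro j
    have : Fin.append f g (Fin.castAdd m j) = f j := Fin.append_left _ _ _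
    exact this ▸ (hf' j).2
  · intro j hj
    obtain ⟨i, rfl⟩ : ∃ i, Fin.natAdd r i = j := ⟨⟨j - r, by omega⟩, by ext; simp; omega⟩
    rw [Fin.append_right]
    exact (hg' i).2

/-! ### Isolating blocks cut out by a block time -/

namespace Flow

section BlockTime

variable {M : Type*} [TopologicalSpace M] (φ : Flow ℝ M)

/-- A section time `τ` on `X`, whose level sets are compact, such that the orbits in `X` approach
`K` as `τ → ∞`, and those in the clopen invariant part `G` of `X`, but no others, approach `K` as
`τ → -∞`. -/
structure IsBlockTime (K X G : Set M) (τ : M → ℝ) : Prop extends φ.IsSectionTime X τ where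
  isCompact : IsCompact K
  isInvariant_core : IsInvariant φ K
  disjoint : Disjoint K X
  nhds : K ∪ X ∈ 𝓝ˢ K
  isCompact_zero : IsCompact {x | x ∈ X ∧ τ x = 0}
  subset : G ⊆ X
  isOpen_left : IsOpen G
  isOpen_diff : IsOpen (X \ G)
  isInvariant_left : IsInvariant φ G
  absorb : ∀ U ∈ 𝓝ˢ K, ∃ T : ℝ, ∀ x ∈ X, T ≤ τ x → x ∈ U
  repel : ∀ U ∈ 𝓝ˢ K, ∃ T : ℝ, ∀ x ∈ G, τ x ≤ -T → x ∈ U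
  mem_of_near : ∃ V ∈ 𝓝ˢ K, ∃ T : ℝ, ∀ x ∈ V, x ∈ X → τ x < -T → x ∈ G

/-- The set obtained from `K` by adding the points of `X` after time `T` and the points of `G`
before time `-T`. -/
def timeBlock (K X G : Set M) (τ : M → ℝ) (T : ℝ) : Set M :=
  K ∪ {x | x ∈ X ∧ T ≤ τ x} ∪ {x | x ∈ G ∧ τ x ≤ -T}

variable {φ} {K X G : Set M} {τ : M → ℝ}

namespace IsBlockTime

variable (h : φ.IsBlockTime K X G τ)
include h

theorem exists_timeBlock_subset {U : Set M} (hU : U ∈ 𝓝ˢ K) :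
    ∃ T₀ : ℝ, ∀ T, T₀ ≤ T → timeBlock K X G τ T ⊆ U := by
  obtain ⟨T₁, h₁⟩ := h.absorb U hU
  obtain ⟨T₂, h₂⟩ := h.repel U hU
  refine ⟨max T₁ T₂, fun T hT x hx => ?_⟩
  have := le_max_left T₁ T₂
  have := le_max_right T₁ T₂
  rcases hx with (hx | hx) | hx
  · exact subset_of_mem_nhdsSet hU hx
  · exact h₁ x hx.1 (by linarith [hx.2])
  · exact h₂ x hx.1 (by linarith [hx.2])

/-- A compact neighbourhood of `K` absorbs the very late points and the very early points of `G`;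
what remains lies in a compact slab. The sets below are then compact as such a `Z` minus an open
set. -/
theorem exists_isCompact_superset [T2Space M] [LocallyCompactSpace M] (T : ℝ) :
    ∃ Z, IsCompact Z ∧ Z ⊆ K ∪ X ∧ K ∪ {x | x ∈ X ∧ T ≤ τ x} ∪ G ⊆ Z := by
  obtain ⟨W, hW, hKW, hWX⟩ := exists_compact_between h.isCompact isOpen_interior
    (subset_interior_iff_mem_nhdsSet.2 h.nhds)
  obtain ⟨T₁, hT₁⟩ := h.exists_timeBlock_subset (subset_interior_iff_mem_nhdsSet.1 hKW)
  let R := max T₁ |T|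
  refine ⟨W ∪ {x | x ∈ X ∧ |τ x| ≤ R}, hW.union (h.isCompact_slab h.isCompact_zero R),
    union_subset (hWX.trans interior_subset) fun x hx => Or.inr hx.1, ?_⟩
  have hR := hT₁ R (le_max_left _ _)
  have hTR : -R ≤ T := by
    have : |T| ≤ R := le_max_right _ _
    linarith [neg_abs_le T]
  rintro x ((hx | ⟨hx, hxT⟩) | hx)
  · exact Or.inl (hR (Or.inl (Or.inl hx)))
  · rcases le_total R (τ x) with hc | hc
    · exact Or.inl (hR (Or.inl (Or.inr ⟨hx, hc⟩)))
    · exact Or.inr ⟨hx, abs_le.2 ⟨by linarith, hc⟩⟩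
  · rcases le_total R (τ x) with hc | hc
    · exact Or.inl (hR (Or.inl (Or.inr ⟨h.subset hx, hc⟩)))
    · rcases le_total (τ x) (-R) with hc' | hc'
      · exact Or.inl (hR (Or.inr ⟨hx, hc'⟩))
      · exact Or.inr ⟨h.subset hx, abs_le.2 ⟨hc', hc⟩⟩

theorem isCompact_union_left [T2Space M] [LocallyCompactSpace M] (T : ℝ) :
    IsCompact (K ∪ {x | x ∈ X ∧ T ≤ τ x} ∪ G) := by
  obtain ⟨Z, hZ, hZX, hsub⟩ := h.exists_isCompact_superset T
  have hO : IsOpen ((X \ G) ∩ {x | x ∈ X ∧ τ x ∈ Iio T}) :=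
    h.isOpen_diff.inter (h.isOpen_preimage isOpen_Iio)
  convert hZ.diff hO using 1
  ext x
  constructor
  · intro hx
    refine ⟨hsub hx, ?_⟩
    rintro ⟨⟨hxX, hxG⟩, -, hxT⟩
    rcases hx with (hx | hx) | hx
    · exact disjoint_left.1 h.disjoint hx hxX
    · exact (not_lt.2 hx.2) hxT
    · exact hxG hx
  · rintro ⟨hxZ, hxO⟩
    by_contra hx
    have h1 : x ∉ K := fun h' => hx (Or.inl (Or.inl h'))
    have h2 : x ∉ G := fun h' => hx (Or.inr h')
    have h3 : x ∈ X := (hZX hxZ).resolve_left h1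
    exact hxO ⟨⟨h3, h2⟩, h3, not_le.1 fun h' => hx (Or.inl (Or.inr ⟨h3, h'⟩))⟩

theorem isCompact_timeBlock [T2Space M] [LocallyCompactSpace M] (T : ℝ) :
    IsCompact (timeBlock K X G τ T) := by
  have hO : IsOpen (G ∩ {x | x ∈ X ∧ τ x ∈ Ioo (-T) T}) :=
    h.isOpen_left.inter (h.isOpen_preimage isOpen_Ioo)
  convert (h.isCompact_union_left T).diff hO using 1
  ext x
  constructor
  · rintro ((hx | hx) | hx)
    · exact ⟨Or.inl (Or.inl hx), fun h' => disjoint_left.1 h.disjoint hx h'.2.1⟩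
    · exact ⟨Or.inl (Or.inr hx), fun h' => not_lt.2 hx.2 h'.2.2.2⟩
    · exact ⟨Or.inr hx.1, fun h' => not_lt.2 hx.2 h'.2.2.1⟩
  · rintro ⟨(hx | hx) | hx, hxO⟩
    · exact Or.inl (Or.inl hx)
    · exact Or.inl (Or.inr hx)
    · rcases le_or_gt T (τ x) with hc | hc
      · exact Or.inl (Or.inr ⟨h.subset hx, hc⟩)
      · exact Or.inr ⟨hx, not_lt.1 fun h' => hxO ⟨hx, h.subset hx, h', hc⟩⟩

/-- The issue is openness at points of `K`: a compact slab is closed and misses `K`, so nearby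
points of `X` are very late or very early, and in the latter case `mem_of_near` puts them in `G`. -/
theorem isOpen_timeBlock_lt [T2Space M] (T : ℝ) :
    IsOpen (K ∪ {x | x ∈ X ∧ T < τ x} ∪ {x | x ∈ G ∧ τ x < -T}) := by
  have h1 : IsOpen {x | x ∈ X ∧ T < τ x} := h.isOpen_preimage isOpen_Ioi
  have h2 : IsOpen {x | x ∈ G ∧ τ x < -T} := by
    convert h.isOpen_left.inter (h.isOpen_preimage (isOpen_Iio (a := -T))) using 1
    ext x
    exact ⟨fun hx => ⟨hx.1, h.subset hx.1, hx.2⟩, fun hx => ⟨hx.1, hx.2.2⟩⟩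
  rw [isOpen_iff_mem_nhds]
  rintro x ((hx | hx) | hx)
  · obtain ⟨V, hV, T', hT'⟩ := h.mem_of_near
    have hslab := h.isCompact_slab h.isCompact_zero (max T T')
    filter_upwards [mem_nhdsSet_iff_forall.1 h.nhds x hx, mem_nhdsSet_iff_forall.1 hV x hx,
      hslab.isClosed.isOpen_compl.mem_nhds fun h' => disjoint_left.1 h.disjoint hx h'.1]
      with y hy hyV hys
    rcases hy with hy | hy
    · exact Or.inl (Or.inl hy)
    have := le_max_left T T'
    have := le_max_right T T'
    have h3 : max T T' < |τ y| := not_le.1 fun h' => hys ⟨hy, h'⟩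
    rcases lt_abs.1 h3 with h3 | h3
    · exact Or.inl (Or.inr ⟨hy, by linarith⟩)
    · exact Or.inr ⟨hT' y hyV hy (by linarith), show τ y < -T by linarith⟩
  · exact mem_of_superset (h1.mem_nhds hx) fun y hy => Or.inl (Or.inr hy)
  · exact mem_of_superset (h2.mem_nhds hx) fun y hy => Or.inr hy

theorem notMem_timeBlock {T : ℝ} {x : M} (hx : x ∈ X) (h1 : τ x < T) (h2 : -T < τ x) :
    x ∉ timeBlock K X G τ T := by
  rintro ((hx' | hx') | hx')
  · exact disjoint_left.1 h.disjoint hx' hx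
  · exact not_lt.2 hx'.2 h1
  · exact not_lt.2 hx'.2 h2

theorem forall_Ico_notMem_timeBlock {T : ℝ} {x : M} (hx : x ∈ X) (hxT : τ x = T) {t : ℝ}
    (ht : t ∈ Ico (-T) 0) : φ t x ∉ timeBlock K X G τ T := by
  obtain ⟨ht1, ht2⟩ := ht
  refine h.notMem_timeBlock (h.isInvariant t hx) ?_ ?_ <;> rw [h.map_flow x hx] <;> linarith

theorem forall_Ioc_notMem_timeBlock {T : ℝ} {x : M} (hx : x ∈ X) (hxT : τ x = -T) {t : ℝ}
    (ht : t ∈ Ioc 0 T) : φ t x ∉ timeBlock K X G τ T := by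
  obtain ⟨ht1, ht2⟩ := ht
  refine h.notMem_timeBlock (h.isInvariant t hx) ?_ ?_ <;> rw [h.map_flow x hx] <;> linarith

/-- A point at level T was outside the block just before, and a point of `G` at level -T is outside
just after, so neither is interior. -/
theorem interior_timeBlock [T2Space M] {T : ℝ} (hT : 0 < T) :
    interior (timeBlock K X G τ T) = K ∪ {x | x ∈ X ∧ T < τ x} ∪ {x | x ∈ G ∧ τ x < -T} := by
  refine Subset.antisymm (fun x hx => ?_) (interior_maximal ?_ (h.isOpen_timeBlock_lt T))
  · have hc : Continuous fun t : ℝ => φ t x := by fun_prop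
    have h0 : ∀ᶠ t in 𝓝 (0 : ℝ), φ t x ∈ timeBlock K X G τ T := by
      have : φ 0 x ∈ interior (timeBlock K X G τ T) := by rwa [φ.map_zero_apply]
      exact mem_of_superset ((isOpen_interior.preimage hc).mem_nhds this)
        fun t ht => interior_subset (s := timeBlock K X G τ T) ht
    rcases interior_subset hx with (hx' | hx') | hx'
    · exact Or.inl (Or.inl hx')
    · refine Or.inl (Or.inr ⟨hx'.1, lt_of_le_of_ne hx'.2 fun he => ?_⟩)
      obtain ⟨t, ht, ht'⟩ := ((h0.filter_mono nhdsWithin_le_nhds).and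
        (Ico_mem_nhdsLT (show -T < 0 by linarith))).exists
      exact h.forall_Ico_notMem_timeBlock hx'.1 he.symm ht' ht
    · refine Or.inr ⟨hx'.1, lt_of_le_of_ne hx'.2 fun he => ?_⟩
      obtain ⟨t, ht, ht'⟩ := ((h0.filter_mono nhdsWithin_le_nhds).and (Ioc_mem_nhdsGT hT)).exists
      exact h.forall_Ioc_notMem_timeBlock (h.subset hx'.1) he ht' ht
  · rintro x ((hx | hx) | hx)
    · exact Or.inl (Or.inl hx)
    · exact Or.inl (Or.inr ⟨hx.1, hx.2.le⟩)
    · exact Or.inr ⟨hx.1, le_of_lt hx.2⟩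

theorem frontier_timeBlock [T2Space M] [LocallyCompactSpace M] {T : ℝ} (hT : 0 < T) :
    frontier (timeBlock K X G τ T) = {x | x ∈ X ∧ τ x = T} ∪ {x | x ∈ G ∧ τ x = -T} := by
  rw [(h.isCompact_timeBlock T).isClosed.frontier_eq, h.interior_timeBlock hT]
  ext x
  constructor
  · rintro ⟨(hx | hx) | hx, hxi⟩
    · exact absurd (Or.inl (Or.inl hx)) hxi
    · exact Or.inl ⟨hx.1, le_antisymm (not_lt.1 fun h' => hxi (Or.inl (Or.inr ⟨hx.1, h'⟩))) hx.2⟩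
    · exact Or.inr ⟨hx.1, le_antisymm hx.2 (not_lt.1 fun h' => hxi (Or.inr ⟨hx.1, h'⟩))⟩
  · rintro (⟨hx, hxT⟩ | ⟨hx, hxT⟩)
    · refine ⟨Or.inl (Or.inr ⟨hx, hxT.ge⟩), ?_⟩
      rintro ((hx' | hx') | hx')
      · exact disjoint_left.1 h.disjoint hx' hx
      · exact hx'.2.ne' hxT
      · have : τ x < -T := hx'.2
        linarith
    · refine ⟨Or.inr ⟨hx, hxT.le⟩, ?_⟩
      rintro ((hx' | hx') | hx')
      · exact disjoint_left.1 h.disjoint hx' (h.subset hx)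
      · have : T < τ x := hx'.2
        linarith
      · exact hx'.2.ne hxT

theorem isCompact_level [T2Space M] (c : ℝ) : IsCompact {x | x ∈ X ∧ τ x = c} :=
  h.toIsSectionTime.isCompact_level h.isCompact_zero (fun _ hx => hx.1)
    (fun x hx => ⟨0 - τ x, h.isInvariant _ hx, h.time_flow_sub 0 hx⟩) c

theorem isCompact_level_inter [T2Space M] {C : Set M} (hC : C ⊆ X) (hd : IsOpen (X \ C)) (c : ℝ) :
    IsCompact {x | x ∈ C ∧ τ x = c} := by
  convert (h.isCompact_level c).diff hd using 1
  ext x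
  exact ⟨fun hx => ⟨⟨hC hx.1, hx.2⟩, fun h' => h'.2 hx.1⟩,
    fun hx => ⟨by_contra fun h' => hx.2 ⟨hx.1.1, h'⟩, hx.1.2⟩⟩

/-- Each orbit of `X` is outside the block when τ = 0, as 0 lies in the gap (-T, T). -/
theorem isIsolatingNeighbourhood_timeBlock [T2Space M] [LocallyCompactSpace M] {T : ℝ}
    (hT : 0 < T) : φ.IsIsolatingNeighbourhood K (timeBlock K X G τ T) := by
  refine ⟨h.isCompact_timeBlock T, ?_, ?_⟩
  · rw [← subset_interior_iff_mem_nhdsSet, h.interior_timeBlock hT]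
    exact fun x hx => Or.inl (Or.inl hx)
  · ext x
    refine ⟨fun hx => ⟨Or.inl (Or.inl hx), fun t => Or.inl (Or.inl (h.isInvariant_core t hx))⟩, ?_⟩
    rintro ⟨hx, hxt⟩
    by_contra hxK
    have hxX : x ∈ X := by
      rcases hx with (hx | hx) | hx
      exacts [absurd hx hxK, hx.1, h.subset hx.1]
    have h1 := h.time_flow_sub 0 hxX
    exact h.notMem_timeBlock (h.isInvariant _ hxX) (by rw [h1]; exact hT)
      (by rw [h1]; linarith) (hxt (0 - τ x))

theorem isIsolatingBlock_timeBlock [T2Space M] [LocallyCompactSpace M] {T : ℝ}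
    (hT : 0 < T) : φ.IsIsolatingBlock K (timeBlock K X G τ T) := by
  have hfr := h.frontier_timeBlock hT
  refine ⟨h.isIsolatingNeighbourhood_timeBlock hT, {x | x ∈ X ∧ τ x = T}, {x | x ∈ G ∧ τ x = -T},
    h.isCompact_level T, h.isCompact_level_inter h.subset h.isOpen_diff _, hfr, ?_, ?_, ?_, ?_⟩
  · exact fun x hx => ⟨T, hT, fun t ht => h.forall_Ico_notMem_timeBlock hx.1 hx.2 ht⟩
  · exact fun x hx => ⟨T, hT, fun t ht => h.forall_Ioc_notMem_timeBlock (h.subset hx.1) hx.2 ht⟩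
  · rw [hfr, h.interior_timeBlock hT]
    rintro x ⟨hx | hx, hxi⟩
    · exact absurd hx hxi
    · refine ⟨1, one_pos, fun t ht => Or.inr ⟨h.isInvariant_left t hx.1, ?_⟩⟩
      show τ (φ t x) < -T
      rw [h.map_flow x (h.subset hx.1), hx.2]
      linarith [ht.2]
  · rw [hfr, h.interior_timeBlock hT]
    rintro x ⟨hx | hx, hxo⟩
    · refine ⟨1, one_pos, fun t ht => Or.inl (Or.inr ⟨h.isInvariant t hx.1, ?_⟩)⟩
      rw [h.map_flow x hx.1, hx.2]
      linarith [ht.1]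
    · exact absurd hx hxo

/-- Forward orbits from the open block around `K` stay in a closed set whose points outside K ∪ G
have τ ≥ T; choosing T beyond τ y rules out this last possibility. -/
theorem posProlongation_subset [T2Space M] [LocallyCompactSpace M] {x : M} (hx : x ∈ K) :
    φ.posProlongation x ⊆ K ∪ G := by
  intro y hy
  have key : ∀ T, 0 < T → y ∈ K ∪ {x | x ∈ X ∧ T ≤ τ x} ∪ G := by
    intro T hT
    have h1 := hy _ (h.isOpen_timeBlock_lt T) (Or.inl (Or.inl hx)) 0 le_rfl
    refine closure_minimal ?_ (h.isCompact_union_left T).isClosed h1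
    rintro _ ⟨t, ht, z, (hz | hz) | hz, rfl⟩
    · exact Or.inl (Or.inl (h.isInvariant_core t hz))
    · refine Or.inl (Or.inr ⟨h.isInvariant t hz.1, ?_⟩)
      rw [h.map_flow z hz.1]
      have : (0 : ℝ) ≤ t := ht
      linarith [hz.2]
    · exact Or.inr (h.isInvariant_left t hz.1)
  rcases key (|τ y| + 1) (by positivity) with (h1 | h1) | h1
  · exact Or.inl h1
  · linarith [h1.2, le_abs_self (τ y)]
  · exact Or.inr h1

end IsBlockTime

end BlockTime

end Flow

/-! ### The block time of an attractor with only internal explosions -/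

namespace Flow

section Attractor

variable {M : Type*} [TopologicalSpace M] {φ : Flow ℝ M} {K : Set M}

theorem disjoint_frontier_of_mem_nhdsSet {V : Set M} (hV : V ∈ 𝓝ˢ K) : Disjoint K (frontier V) :=
  disjoint_left.2 fun _ hx hx' => hx'.2 (subset_interior_iff_mem_nhdsSet.2 hV hx)

theorem frontier_subset_basin_diff [T2Space M] {V : Set M} (hVc : IsCompact V) (hV : V ∈ 𝓝ˢ K)
    (hVA : V ⊆ φ.basin K) : frontier V ⊆ φ.basin K \ K := fun _ hx =>
  ⟨hVA (hVc.isClosed.frontier_subset hx), disjoint_right.1 (disjoint_frontier_of_mem_nhdsSet hV) hx⟩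

/-- Every orbit of the basin outside `K` crosses the frontier of a small neighbourhood of `K`. -/
theorem exists_mem_frontier_of_mem_basin_diff {V : Set M} (hV : V ∈ 𝓝ˢ K)
    (hiso : ∀ x, (∀ t, φ t x ∈ V) → x ∈ K) {x : M} (hx : x ∈ φ.basin K \ K) :
    ∃ t, φ t x ∈ frontier V := by
  by_contra! hno
  refine hx.2 (hiso x fun t => ?_)
  obtain ⟨z, hz⟩ := hx.1.1
  obtain ⟨u, -, hu⟩ := φ.exists_ge_mem_of_mem_omegaSet hz
    (mem_nhdsSet_iff_forall.1 hV z (hx.1.2 hz)) 0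
  exact interior_subset (φ.mem_interior_of_forall_notMem_frontier isPreconnected_univ
    (fun t _ => hno t) (mem_univ u) (mem_univ t) hu)

namespace IsAttractorWithOnlyInternalExplosions

variable (hK : φ.IsAttractorWithOnlyInternalExplosions K)
include hK

theorem isOpen_basin_diff [T2Space M] : IsOpen (φ.basin K \ K) :=
  (φ.isOpen_basin hK.1.2).sdiff hK.1.1.1.isClosed

theorem isInvariant_basin_diff : IsInvariant φ (φ.basin K \ K) :=
  φ.isInvariant_diff (φ.isInvariant_basin K) hK.1.1.2.1

theorem exists_forall_ge_mem [T2Space M] [LocallyCompactSpace M] {Q : Set M} (hQ : IsCompact Q)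
    (hQX : Q ⊆ φ.basin K \ K) {U : Set M} (hU : U ∈ 𝓝ˢ K) :
    ∃ T : ℝ, ∀ y ∈ Q, ∀ t, T ≤ t → φ t y ∈ U := by
  obtain ⟨W, hW, hKW, hWU⟩ := exists_compact_between hK.1.1.1 isOpen_interior
    (subset_interior_iff_mem_nhdsSet.2 hU)
  obtain ⟨T, hT⟩ := φ.exists_forall_ge_mem_of_isCompact hW
    (subset_interior_iff_mem_nhdsSet.1 hKW) hQ (hQX.trans sdiff_subset)
    fun x hx => hK.2 x (hQX hx)
  exact ⟨T, fun y hy t ht => interior_subset (hWU (hT y hy t ht))⟩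

/-- The complement of `Q` is itself a neighbourhood of `K`, so uniform attraction applies to it. -/
theorem exists_forall_ge_notMem [T2Space M] [LocallyCompactSpace M] {Q : Set M}
    (hQ : IsCompact Q) (hQX : Q ⊆ φ.basin K \ K) :
    ∃ T : ℝ, ∀ y ∈ Q, ∀ t, T ≤ t → φ t y ∉ Q :=
  hK.exists_forall_ge_mem hQ hQX (hQ.isClosed.isOpen_compl.mem_nhdsSet.2
    fun _ hx hx' => (hQX hx').2 hx)

theorem exists_compact_nhds_subset_basin [T2Space M] [LocallyCompactSpace M] :
    ∃ V, IsCompact V ∧ V ∈ 𝓝ˢ K ∧ V ⊆ φ.basin K ∧ ∀ x, (∀ t, φ t x ∈ V) → x ∈ K := by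
  obtain ⟨N, -, hN, hKN⟩ := hK.1.1.2.2
  obtain ⟨V, hV, hKV, hVN⟩ := exists_compact_between hK.1.1.1 isOpen_interior
    (subset_interior_iff_mem_nhdsSet.2 (inter_mem hN hK.1.2))
  refine ⟨V, hV, subset_interior_iff_mem_nhdsSet.1 hKV,
    fun x hx => (interior_subset (hVN hx)).2, fun x hx => ?_⟩
  have hxN : ∀ t, φ t x ∈ N := fun t => (interior_subset (hVN (hx t))).1
  rw [hKN]
  exact ⟨by simpa only [φ.map_zero_apply] using hxN 0, hxN⟩

/-- The homoclinic points outside `K` form a clopen subset of the basin outside `K`, and the basin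
carries a section time adapted to it. -/
theorem exists_isBlockTime [T2Space M] [LocallyCompactSpace M] [FirstCountableTopology M] :
    ∃ τ, φ.IsBlockTime K (φ.basin K \ K) (φ.homoclinicSet K \ K) τ := by
  set X := φ.basin K \ K with hXdef
  have hKX : K ∪ X = φ.basin K :=
    union_sdiff_cancel (φ.subset_basin hK.1.1.1 hK.1.1.2.1)
  obtain ⟨V, hVc, hV, hVA, hiso⟩ := hK.exists_compact_nhds_subset_basin
  have hP : IsCompact (frontier V) :=
    hVc.of_isClosed_subset isClosed_frontier hVc.isClosed.frontier_subset
  have hPX : frontier V ⊆ X := frontier_subset_basin_diff hVc hV hVA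
  obtain ⟨τ, hτ⟩ := φ.exists_isSectionTime hK.isOpen_basin_diff hK.isInvariant_basin_diff hP hPX
    (fun x hx => exists_mem_frontier_of_mem_basin_diff hV hiso hx) fun Q hQ hQX => hK.exists_forall_ge_notMem hQ hQX
  have hS : IsCompact {x | x ∈ X ∧ τ x = 0} :=
    hτ.isCompact_level hP hPX (fun x hx => exists_mem_frontier_of_mem_basin_diff hV hiso hx) 0
  have hbound : ∀ W, IsCompact W → W ∈ 𝓝ˢ K → W ⊆ φ.basin K →
      ∃ R : ℝ, ∀ x ∈ frontier W, -R ≤ τ x := by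
    intro W hWc hW hWA
    have hF : IsCompact (frontier W) :=
      hWc.of_isClosed_subset isClosed_frontier hWc.isClosed.frontier_subset
    obtain ⟨R, hR⟩ := (hF.image_of_continuousOn
      (hτ.continuousOn.mono (frontier_subset_basin_diff hWc hW hWA))).bddBelow
    exact ⟨-R, fun x hx => by simpa using hR ⟨x, hx, rfl⟩⟩
  -- Before time -R an orbit cannot meet the frontier of `W`, so it is inside at all such times or
  -- at none.
  have hcross : ∀ (W : Set M) (R : ℝ), (∀ x ∈ frontier W, -R ≤ τ x) → ∀ x ∈ X, ∀ a b : ℝ,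
      τ x + a < -R → τ x + b < -R → φ a x ∈ W → φ b x ∈ interior W := by
    intro W R hR x hx a b ha hb haW
    refine φ.mem_interior_of_forall_notMem_frontier (isPreconnected_Iio (a := -R - τ x))
      (fun t ht hF => ?_) (mem_Iio.2 (by linarith)) (mem_Iio.2 (by linarith)) haW
    have h1 := hR _ hF
    rw [hτ.map_flow x hx] at h1
    linarith [mem_Iio.1 ht]
  have hnear : ∀ W ∈ 𝓝ˢ K, ∀ x ∈ φ.homoclinicSet K, ∀ T : ℝ, ∃ t, t ≤ T ∧ φ t x ∈ W := by
    rintro W hW x ⟨-, ⟨z, hz⟩, hα⟩ T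
    exact φ.exists_le_mem_of_mem_alphaSet hz (mem_nhdsSet_iff_forall.1 hW z (hα hz)) T
  obtain ⟨R, hR⟩ := hbound V hVc hV hVA
  have hhom : ∀ x ∈ X, ∀ a, τ x + a < -R → (x ∈ φ.homoclinicSet K ↔ φ a x ∈ V) := by
    intro x hx a ha
    constructor
    · intro hxH
      obtain ⟨t, ht, htV⟩ := hnear V hV x hxH a
      exact interior_subset (hcross V R hR x hx t a (by linarith) ha htV)
    · intro haV
      obtain ⟨hne, hsub⟩ := φ.alphaSet_of_forall_le_mem hVc (x := x) (T := a) fun t ht =>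
        interior_subset (hcross V R hR x hx a t ha (by linarith) haV)
      -- The alpha-limit set is an invariant subset of the isolating set `V`, hence contained in
      -- `K`.
      exact ⟨hx.1, hne, fun y hy => hiso y fun t => hsub (φ.isInvariant_alphaSet x t hy)⟩
  -- Any level below -R would do. Homoclinicity of x becomes the condition ψ x ∈ V, equivalently ψ x
  -- ∈ int V: one form is closed, the other open.
  let ψ : M → M := fun x => φ (-R - 1 - τ x) x
  have hψ : ContinuousOn ψ X := hτ.continuousOn_flow_sub _
  have hψV : ∀ x ∈ X, (x ∈ φ.homoclinicSet K ↔ ψ x ∈ V) := fun x hx => hhom x hx _ (by linarith)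
  have hψi : ∀ x ∈ X, ψ x ∈ V → ψ x ∈ interior V := fun x hx =>
    hcross V R hR x hx _ _ (by linarith) (by linarith)
  have hsubset : φ.homoclinicSet K \ K ⊆ X := sdiff_subset_sdiff_left fun x hx => hx.1
  refine ⟨τ, ⟨hτ, hK.1.1.1, hK.1.1.2.1, disjoint_sdiff_right, hKX ▸ hK.1.2, hS, hsubset, ?_, ?_,
    ?_, ?_, ?_, ?_⟩⟩
  · convert hψ.isOpen_inter_preimage hτ.isOpen isOpen_interior (t := interior V) using 1
    ext x
    exact ⟨fun hx => ⟨hsubset hx, hψi x (hsubset hx) ((hψV x (hsubset hx)).1 hx.1)⟩,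
      fun hx => ⟨(hψV x hx.1).2 (interior_subset hx.2), hx.1.2⟩⟩
  · convert hψ.isOpen_inter_preimage hτ.isOpen hVc.isClosed.isOpen_compl using 1
    ext x
    exact ⟨fun hx => ⟨hx.1, fun h' => hx.2 ⟨(hψV x hx.1).2 h', hx.1.2⟩⟩,
      fun hx => ⟨hx.1, fun h' => hx.2 ((hψV x hx.1).1 h'.1)⟩⟩
  · refine φ.isInvariant_diff (fun t x hx => ?_) hK.1.1.2.1
    exact ⟨φ.isInvariant_basin K t hx.1, by rw [alphaSet_flow]; exact hx.2⟩
  · intro U hU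
    obtain ⟨T, hT⟩ := hK.exists_forall_ge_mem hS (fun x hx => hx.1) hU
    refine ⟨T, fun x hx hxT => ?_⟩
    have := hT (φ (0 - τ x) x) ⟨hτ.isInvariant _ hx, hτ.time_flow_sub 0 hx⟩ (τ x) hxT
    rwa [zero_sub, flow_flow_neg] at this
  · intro U hU
    -- The dichotomy is rerun with a smaller `W` inside `U`. Its bound `R'` is independent of x, so
    -- the repulsion is uniform on the homoclinic points.
    obtain ⟨W, hWc, hKW, hWU⟩ := exists_compact_between hK.1.1.1 isOpen_interior
      (subset_interior_iff_mem_nhdsSet.2 (inter_mem hU hV))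
    have hW : W ∈ 𝓝ˢ K := subset_interior_iff_mem_nhdsSet.1 hKW
    have hWUV : W ⊆ U ∩ V := hWU.trans interior_subset
    obtain ⟨R', hR'⟩ := hbound W hWc hW fun x hx => hVA (hWUV hx).2
    refine ⟨R' + 1, fun x hx hxR => ?_⟩
    obtain ⟨t, ht, htW⟩ := hnear W hW x hx.1 0
    have := hcross W R' hR' x (hsubset hx) t 0 (by linarith) (by linarith) htW
    rw [φ.map_zero_apply] at this
    exact (hWUV (interior_subset this)).1
  · refine ⟨V, hV, R, fun x hxV hx hxR => ⟨?_, hx.2⟩⟩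
    rw [hhom x hx 0 (by linarith), φ.map_zero_apply]
    exact hxV

end IsAttractorWithOnlyInternalExplosions

/-- The orbit of x is near y at arbitrarily negative times, and from there it flows forward exactly
to x. -/
theorem mem_posProlongation_of_mem_alphaSet {x y : M} (hy : y ∈ φ.alphaSet x) :
    x ∈ φ.posProlongation y := by
  intro U hU hyU T hT
  obtain ⟨t, ht, htU⟩ := φ.exists_le_mem_of_mem_alphaSet hy (hU.mem_nhds hyU) (-T)
  exact subset_closure ⟨-t, mem_Ici.2 (by linarith), φ t x, htU, φ.flow_neg_flow t x⟩

theorem homoclinicSet_subset_stabilization (φ : Flow ℝ M) (K : Set M) :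
    φ.homoclinicSet K ⊆ φ.stabilization K := by
  rintro x ⟨-, ⟨y, hy⟩, hα⟩
  exact mem_iUnion₂.2 ⟨y, hα hy, mem_posProlongation_of_mem_alphaSet hy⟩

end Attractor

end Flow

/-! ### Assembly of the theorem -/

theorem mainTheorem12 {M : Type*} [TopologicalSpace M] [TopologicalSpace.MetrizableSpace M]
    [LocallyCompactSpace M] [LocallyConnectedSpace M] (φ : Flow ℝ M) (K : Set M)
    (hK : φ.IsAttractorWithOnlyInternalExplosions K) :
    ∃ (s r : ℕ) (hrs : r ≤ s) (C : Fin s → Set M),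
      Function.Injective C ∧ range C = componentsOf (φ.basin K \ K) ∧
      φ.stabilization K = φ.homoclinicSet K ∧
      φ.homoclinicSet K = K ∪ ⋃ j : Fin r, C (Fin.castLE hrs j) ∧
      φ.basin K = φ.stabilization K ∪ ⋃ (j : Fin s) (_ : r ≤ (j : ℕ)), C j ∧
      ∀ U ∈ 𝓝ˢ K, ∃ N : Set M, N ⊆ U ∧ φ.IsIsolatingBlock K N ∧
        ∃ (nminus : Fin r → Set M) (nplus : Fin s → Set M),
          Function.Injective (Sum.elim nminus nplus) ∧
          range (Sum.elim nminus nplus) = componentsOf (frontier N) ∧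
          (∀ j, nminus j ⊆ φ.negAsymptoticSet N) ∧
          (∀ j, nplus j ⊆ φ.posAsymptoticSet N) ∧
          (∀ j, φ.IsTopologicalSection (nminus j) (C (Fin.castLE hrs j))) ∧
          (∀ j, φ.IsTopologicalSection (nplus j) (C j)) := by
  obtain ⟨τ, h⟩ := hK.exists_isBlockTime
  set X := φ.basin K \ K with hXdef
  set G := φ.homoclinicSet K \ K with hGdef
  have hKA := φ.subset_basin hK.1.1.1 hK.1.1.2.1
  have hKH := φ.subset_homoclinicSet hK.1.1.1 hK.1.1.2.1
  have hinv : ∀ C ∈ componentsOf X, IsInvariant φ C := fun C hC =>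
    φ.isInvariant_of_mem_componentsOf h.isInvariant hC
  have hfin : (componentsOf X).Finite := by
    refine finite_componentsOf_of_isCompact h.isOpen h.isCompact_zero (fun x hx => hx.1)
      fun C hC => ?_
    obtain ⟨x, hx⟩ := (isConnected_of_mem_componentsOf hC).nonempty
    have hxX := subset_of_mem_componentsOf hC hx
    exact ⟨φ (0 - τ x) x, hinv C hC _ hx, h.isInvariant _ hxX, h.time_flow_sub 0 hxX⟩
  obtain ⟨s, r, hrs, C, hCinj, hCrange, hCG, hCnG⟩ := hfin.exists_enumeration (· ⊆ G)
  have hC : ∀ j, C j ∈ componentsOf X := fun j => hCrange ▸ mem_range_self j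
  have hCX : ∀ j, C j ⊆ X := fun j => subset_of_mem_componentsOf (hC j)
  -- Since `G` is clopen in `X`, a component not contained in it misses it.
  have hCdiff : ∀ j : Fin s, r ≤ (j : ℕ) → Disjoint (C j) G := by
    intro j hj
    have h1 := (isConnected_of_mem_componentsOf (hC j)).isPreconnected.subset_or_subset
      h.isOpen_left h.isOpen_diff disjoint_sdiff_right
      (by rw [union_sdiff_cancel h.subset]; exact hCX j)
    exact disjoint_left.2 fun x hx => ((h1.resolve_left (hCnG j hj)) hx).2
  have hCmem : ∀ x ∈ X, ∃ j, x ∈ C j := by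
    intro x hx
    obtain ⟨D, hD, hxD⟩ := (sUnion_componentsOf (X := X)).symm ▸ hx
    obtain ⟨j, rfl⟩ : D ∈ range C := hCrange ▸ hD
    exact ⟨j, hxD⟩
  have hG : G = ⋃ j : Fin r, C (Fin.castLE hrs j) := by
    refine Subset.antisymm (fun x hx => ?_) (iUnion_subset hCG)
    obtain ⟨j, hj⟩ := hCmem x (h.subset hx)
    have hjr : (j : ℕ) < r := not_le.1 fun hle => disjoint_left.1 (hCdiff j hle) hj hx
    exact mem_iUnion.2 ⟨⟨j, hjr⟩, hj⟩
  have hH : φ.homoclinicSet K = K ∪ G := (union_sdiff_cancel hKH).symm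
  have hstab : φ.stabilization K = φ.homoclinicSet K := by
    refine Subset.antisymm ?_ (φ.homoclinicSet_subset_stabilization K)
    rw [hH]
    exact iUnion₂_subset fun x hx => h.posProlongation_subset hx
  refine ⟨s, r, hrs, C, hCinj, hCrange, hstab, by rw [hH, ← hG], ?_, fun U hU => ?_⟩
  · rw [hstab, hH]
    refine Subset.antisymm (fun x hx => ?_) ?_
    · by_cases hxK : x ∈ K
      · exact Or.inl (Or.inl hxK)
      obtain ⟨j, hj⟩ := hCmem x ⟨hx, hxK⟩
      rcases lt_or_ge (j : ℕ) r with hjr | hjr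
      · exact Or.inl (Or.inr (hCG ⟨j, hjr⟩ hj))
      · exact Or.inr (mem_iUnion₂.2 ⟨j, hjr, hj⟩)
    · exact union_subset (union_subset hKA fun x hx => (h.subset hx).1)
        (iUnion₂_subset fun j _ x hx => (hCX j hx).1)
  · obtain ⟨T₀, hT₀⟩ := h.exists_timeBlock_subset hU
    -- The 1 keeps T positive, so the levels T and -T are distinct.
    let T := max T₀ 1
    have hT : 0 < T := lt_of_lt_of_le one_pos (le_max_right _ _)
    let A : Fin r ⊕ Fin s → Set M := Sum.elim
      (fun j => {x | x ∈ C (Fin.castLE hrs j) ∧ τ x = -T}) (fun j => {x | x ∈ C j ∧ τ x = T})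
    have hcomp : ∀ (j : Fin s) (c : ℝ), IsCompact {x | x ∈ C j ∧ τ x = c} := fun j c =>
      h.isCompact_level_inter (hCX j) (isOpen_diff_of_mem_componentsOf h.isOpen (hC j)) c
    have hconn : ∀ (j : Fin s) (c : ℝ), IsConnected {x | x ∈ C j ∧ τ x = c} := by
      intro j c
      -- The level is the image of the whole component under sliding to time c.
      convert (isConnected_of_mem_componentsOf (hC j)).image _
        ((h.continuousOn_flow_sub c).mono (hCX j)) using 1
      ext x
      constructor
      · rintro ⟨hx, hxc⟩
        exact ⟨x, hx, by simp only [hxc, sub_self, φ.map_zero_apply]⟩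
      · rintro ⟨y, hy, rfl⟩
        exact ⟨hinv _ (hC j) _ hy, h.time_flow_sub c (hCX j hy)⟩
    have hAconn : ∀ i, IsConnected (A i) := by
      rintro (i | i)
      exacts [hconn _ _, hconn _ _]
    have hCd : ∀ {i j : Fin s} {x : M}, x ∈ C i → x ∈ C j → i = j := by
      intro i j x hi hj
      by_contra hne
      exact disjoint_left.1 (disjoint_of_mem_componentsOf (hC i) (hC j) (hCinj.ne hne)) hi hj
    have hAdisj : Pairwise fun i j => Disjoint (A i) (A j) := by
      rintro (i | i) (j | j) hne <;> refine disjoint_left.2 ?_ <;> rintro x ⟨hx, hxT⟩ ⟨hy, hyT⟩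
      · exact hne (congrArg Sum.inl (Fin.castLE_injective hrs (hCd hx hy)))
      · linarith
      · linarith
      · exact hne (congrArg Sum.inr (hCd hx hy))
    have hAunion : frontier (Flow.timeBlock K X G τ T) = ⋃ i, A i := by
      rw [h.frontier_timeBlock hT, iUnion_sum, union_comm]
      congr 1
      · ext x
        simp only [A, Sum.elim_inl, mem_iUnion, mem_ofPred_eq, hG, exists_and_right]
      · ext x
        simp only [A, Sum.elim_inr, mem_iUnion, mem_ofPred_eq, exists_and_right]
        exact and_congr_left fun _ => ⟨hCmem x, fun ⟨j, hj⟩ => hCX j hj⟩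
    refine ⟨Flow.timeBlock K X G τ T, hT₀ T (le_max_left _ _), h.isIsolatingBlock_timeBlock hT,
      A ∘ Sum.inl, A ∘ Sum.inr, ?_, ?_, ?_, ?_, ?_, ?_⟩ <;> try rw [Sum.elim_comp_inl_inr]
    · intro i j hij
      by_contra hne
      obtain ⟨x, hx⟩ := (hAconn i).nonempty
      exact disjoint_left.1 (hAdisj hne) hx (hij ▸ hx)
    · rw [hAunion, componentsOf_iUnion (fun i => ?_) hAconn hAdisj]
      rcases i with i | i
      exacts [(hcomp _ _).isClosed, (hcomp _ _).isClosed]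
    · rintro j x ⟨hx, hxT⟩
      refine ⟨Or.inr ⟨hCG j hx, hxT.le⟩, fun t ht => Or.inr ⟨h.isInvariant_left t (hCG j hx), ?_⟩⟩
      show τ (φ t x) ≤ -T
      rw [h.map_flow x (hCX _ hx), hxT]
      linarith
    · rintro j x ⟨hx, hxT⟩
      refine ⟨Or.inl (Or.inr ⟨hCX j hx, hxT.ge⟩),
        fun t ht => Or.inl (Or.inr ⟨h.isInvariant t (hCX j hx), ?_⟩)⟩
      rw [h.map_flow x (hCX _ hx), hxT]
      linarith
    · exact fun j => h.isTopologicalSection (hCX _) (hinv _ (hC _)) (-T) (hcomp _ _)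
    · exact fun j => h.isTopologicalSection (hCX _) (hinv _ (hC _)) T (hcomp _ _)
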